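/- Let $d\ge 2$, let $X=\{1,\dots,d\}^{\mathbb N}$ be the one-sided full shift space with shift $\sigma$, let $0<\theta<1$, and give $X$ the metric $d_\theta(x,y)=\theta^{N}$, where $N\ge 1$ is the first index with $x_N\ne y_N$ (and $d_\theta(x,x)=0$). Let $f:X\to\mathbb R$ be strictly positive and Lipschitz for $d_\theta$. Write $f^n=\sum_{i<n}f\circ\sigma^i$ and $\beta(f)=\sup_\nu\int f\,d\nu$, the supremum over the $\sigma$-invariant Borel probabilities $\nu$; a $\nu$ attaining it is called maximizing. For a periodic point $x$ with minimal period $n_x$ put $I(x)=n_x\bigl(\beta(f)-f^{n_x}(x)/n_x\bigr)$, and for $x\in X$ put $$\widetilde I(x)=\lim_{\epsilon\to0^+}\inf\{I(y): y\text{ periodic},\ d_\theta(y,x)\le\epsilon\}\in\mathbb R\cup\{\infty\}.$$ A calibrated sub-action of $f$ is a continuous $V:X\to\mathbb R$ with $V(y)=\max_{\sigma(x)=y}\bigl(V(x)+f(x)-\beta(f)\bigr)$ for all $y$, and the Baraviera–Lopes–Thieullen deviation function built from such a $V$ is $$I_{BLT}(x)=\sum_{n\ge0}\bigl(V\circ\sigma-V-f+\beta(f)\bigr)(\sigma^n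 x)\in[0,\infty].$$ Suppose that $f$ has a unique maximizing probability. Then calibrated sub-actions of $f$ exist, and there is a cylinder $k\subset X$ such that $$\inf_{x\in k}\widetilde I(x)\ne\inf_{x\in k}I_{BLT}(x)$$ for every choice of the calibrated sub-action $V$. For the same cylinder $k$, if for every $c>0$ the measure $\mu_{cf}$ is the Gibbs state of $cf$ (that is, $\mu_{cf}=h\nu$ with $h>0$ a continuous eigenfunction of the Ruelle operator of $cf$ and $\nu$ an eigenprobability of its dual for the same eigenvalue, $\int h\,d\nu=1$), then $\frac1c\log\mu_{cf}(k)$ does not converge to $-\inf_{x\in k}\widetilde I(x)$ as $c\to\infty$. In particular, any deviation function of the family $(\mu_{cf})$ has an infimum on $k$ different from $\inf_k\widetilde I$. -/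

import Mathlib

open MeasureTheory Filter Topology
open scoped ENNReal

namespace Bernoulli

/-- The one-sided full shift space on `d` symbols, with its product topology and
Borel (product) sigma-algebra. -/
abbrev Space (d : ℕ) : Type := ℕ → Fin d

/-- The shift map. -/
def shift {d : ℕ} (x : Space d) : Space d := fun n => x (n + 1)

/-- The point `a y₀ y₁ y₂ …`; the preimages of `y` under the shift are the points `cons a y`. -/
def cons {d : ℕ} (a : Fin d) (y : Space d) : Space d
  | 0 => a
  | n + 1 => y n

/-- The metric `d_θ`: `θ ^ N` where `N` is the first index, counted from `1`,
at which the two points differ. -/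
noncomputable def thetaDist {d : ℕ} (θ : ℝ) (x y : Space d) : ℝ :=
  open Classical in if x = y then 0 else θ ^ (PiNat.firstDiff x y + 1)

/-- Lipschitz functions for the metric `d_θ`. -/
def IsLipschitz {d : ℕ} (θ : ℝ) (f : Space d → ℝ) : Prop :=
  ∃ C : ℝ, ∀ x y, |f x - f y| ≤ C * thetaDist θ x y

/-- Cylinders: the sets of all points that share a given finite initial word. -/
def IsCylinder {d : ℕ} (k : Set (Space d)) : Prop :=
  ∃ (x : Space d) (m : ℕ), k = PiNat.cylinder x m

/-- Shift-invariant Borel probability measures. -/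
def IsInvariantProb {d : ℕ} (ν : Measure (Space d)) : Prop :=
  IsProbabilityMeasure ν ∧ MeasurePreserving shift ν ν

/-- The maximal value `β(f)` of the integral of `f` over the invariant probabilities. -/
noncomputable def maxValue {d : ℕ} (f : Space d → ℝ) : ℝ :=
  sSup {r : ℝ | ∃ ν : Measure (Space d), IsInvariantProb ν ∧ r = ∫ x, f x ∂ν}

/-- Maximizing probabilities of `f`. -/
def IsMaximizing {d : ℕ} (f : Space d → ℝ) (ν : Measure (Space d)) : Prop :=
  IsInvariantProb ν ∧ ∫ x, f x ∂ν = maxValue f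

/-- The function `I(x) = n_x (β(f) - f^{n_x}(x) / n_x)`, where `n_x` is the minimal period of `x`
and `f^n` the Birkhoff sum; it is used at periodic points only. -/
noncomputable def perRate {d : ℕ} (f : Space d → ℝ) (x : Space d) : ℝ :=
  (Function.minimalPeriod shift x : ℝ) *
    (maxValue f - birkhoffSum shift f (Function.minimalPeriod shift x) x /
      (Function.minimalPeriod shift x : ℝ))

/-- `inf {I(y) : y periodic, d_θ(y, x) ≤ ε}`. -/
noncomputable def ballInf {d : ℕ} (θ : ℝ) (f : Space d → ℝ) (x : Space d) (ε : ℝ) : EReal :=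
  ⨅ y ∈ {y : Space d | y ∈ Function.periodicPts shift ∧ thetaDist θ y x ≤ ε}, (perRate f y : EReal)

/-- The deviation function `Ĩ` of the zeta measures: the limit of `ballInf θ f x ε` as `ε`
decreases to `0`, which is a supremum by monotonicity (see `tendsto_ballInf`). -/
noncomputable def zetaRate {d : ℕ} (θ : ℝ) (f : Space d → ℝ) (x : Space d) : EReal :=
  ⨆ ε ∈ Set.Ioi (0 : ℝ), ballInf θ f x ε

theorem tendsto_ballInf {d : ℕ} (θ : ℝ) (f : Space d → ℝ) (x : Space d) :
    Tendsto (ballInf θ f x) (𝓝[>] 0) (𝓝 (zetaRate θ f x)) := by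
  have hanti : Antitone (ballInf θ f x) := fun a b hab =>
    biInf_mono fun y hy => ⟨hy.1, hy.2.trans hab⟩
  have h := hanti.tendsto_nhdsGT 0
  rwa [sSup_image] at h

/-- Calibrated (also called strict) sub-actions of `f`: continuous functions `V` with
`V(y) = max {V(x) + f(x) - β(f) : σ(x) = y}` for all `y`. -/
def IsCalibratedSubaction {d : ℕ} (f V : Space d → ℝ) : Prop :=
  Continuous V ∧ ∀ y, IsGreatest {r : ℝ | ∃ x, shift x = y ∧ r = V x + f x - maxValue f} (V y)

/-- The Baraviera–Lopes–Thieullen deviation function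
`I_BLT(x) = ∑_{n ≥ 0} (V ∘ σ - V - f + β(f)) (σⁿ x)`, built from a calibrated sub-action `V`.
For such `V` all the terms are non-negative. -/
noncomputable def bltRate {d : ℕ} (f V : Space d → ℝ) (x : Space d) : EReal :=
  ((∑' n : ℕ, ENNReal.ofReal (V (shift^[n + 1] x) - V (shift^[n] x) - f (shift^[n] x) + maxValue f)
    : ℝ≥0∞) : EReal)

/-- The Ruelle transfer operator of the potential `g`. -/
noncomputable def ruelle {d : ℕ} (g u : Space d → ℝ) (y : Space d) : ℝ :=
  ∑ a : Fin d, Real.exp (g (cons a y)) * u (cons a y)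

/-- `μ` is the Gibbs (equilibrium) state of the potential `g`: `μ = h ν`, where `h > 0` is a
continuous eigenfunction of the transfer operator, `ν` a probability that is an eigenmeasure of its
dual for the same eigenvalue, and `∫ h dν = 1`. -/
def IsGibbsState {d : ℕ} (g : Space d → ℝ) (μ : Measure (Space d)) : Prop :=
  ∃ (lam : ℝ) (h : Space d → ℝ) (ν : Measure (Space d)),
    0 < lam ∧ Continuous h ∧ (∀ x, 0 < h x) ∧ IsProbabilityMeasure ν ∧
    (∀ y, ruelle g h y = lam * h y) ∧
    (∀ u : Space d → ℝ, Continuous u → ∫ y, ruelle g u y ∂ν = lam * ∫ x, u x ∂ν) ∧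
    ∫ x, h x ∂ν = 1 ∧
    μ = ν.withDensity (fun x => ENNReal.ofReal (h x))

end Bernoulli

namespace Bernoulli

/-! ### Shift, cylinders and oscillation estimates -/

variable {d : ℕ}

/-! The two rates count the cost of a non-maximizing fixed point differently. Distinct fixed points
carry distinct Dirac masses, so uniqueness forces some `a` with `I = β(f) - f(aaa…) > 0`. The fixed
point approximates itself, so the zeta rate there is at most `I`: a single period is charged. An
orbit starting in the cylinder `k` of the word `a^N` instead pays about `I` at each of its first `N`
steps, so `I_BLT ≥ N I - 2B` on `k`, one `B` bounding the distortion of Birkhoff sums and the other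
the oscillation of any calibrated `V` (`le_bltRate_of_mem_cylinder`). Take `N` with `N I - 2B > I`.

The Gibbs states obey the same bound for each fixed `c > 0`, `μ_{cf}(k) ≤ exp(-c (N I - 2B))`
(`log_cylinder_div_le`), so no large deviation principle is needed. Calibrated sub-actions arise as
the limsup of bounded iterates of the max-plus operator. -/

theorem continuous_shift : Continuous (shift : Space d → Space d) :=
  continuous_pi fun n => continuous_apply (n + 1)

@[simp] theorem shift_cons (a : Fin d) (y : Space d) : shift (cons a y) = y := rfl

theorem cons_shift (x : Space d) : cons (x 0) (shift x) = x := by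
  funext n
  cases n <;> rfl

theorem iterate_shift_apply (n i : ℕ) (x : Space d) : shift^[n] x i = x (i + n) := by
  induction n generalizing x with
  | zero => rfl
  | succ n ih => rw [Function.iterate_succ_apply, ih]; exact congrArg x (by omega)

theorem cons_mem_cylinder {x y : Space d} {m : ℕ} (h : y ∈ PiNat.cylinder x m) (a : Fin d) :
    cons a y ∈ PiNat.cylinder (cons a x) (m + 1) := by
  intro i hi
  cases i with
  | zero => rfl
  | succ i => exact h i (by omega)

theorem shift_mem_cylinder {x y : Space d} {m : ℕ} (h : y ∈ PiNat.cylinder x (m + 1)) :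
    shift y ∈ PiNat.cylinder (shift x) m :=
  fun i hi => h (i + 1) (by omega)

theorem isClopen_cylinder (x : Space d) (m : ℕ) : IsClopen (PiNat.cylinder x m) := by
  refine ⟨?_, PiNat.isOpen_cylinder _ x m⟩
  rw [PiNat.cylinder_eq_pi]
  exact isClosed_set_pi fun i _ => isClosed_singleton

/-- The variation of `f` on cylinders of length `m` is at most `B (1 - θ) θ ^ m`. -/
def VariationBound (θ B : ℝ) (f : Space d → ℝ) : Prop :=
  ∀ (m : ℕ) (x y : Space d), y ∈ PiNat.cylinder x m → f y - f x ≤ B * (1 - θ) * θ ^ m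

/-- The factor `1 - θ` normalizes `B` so that the variations at scales `0, …, n - 1` sum to `B (1 -
θ ^ n) ≤ B`. -/
theorem IsLipschitz.exists_variationBound {θ : ℝ} (hθ0 : 0 < θ) (hθ1 : θ < 1) {f : Space d → ℝ}
    (hf : IsLipschitz θ f) : ∃ B, 0 ≤ B ∧ VariationBound θ B f := by
  obtain ⟨C, hC⟩ := hf
  have h1 : 0 < 1 - θ := by linarith
  refine ⟨|C| / (1 - θ), by positivity, fun m x y hy => ?_⟩
  rw [div_mul_cancel₀ _ h1.ne']
  rcases eq_or_ne x y with rfl | hne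
  · rw [sub_self]; positivity
  · refine (le_abs_self _).trans ((hC y x).trans ?_)
    rw [thetaDist, if_neg hne.symm]
    have hm : m ≤ PiNat.firstDiff y x := by
      rw [PiNat.firstDiff_comm]
      exact (PiNat.mem_cylinder_iff_le_firstDiff hne m).1 ((PiNat.mem_cylinder_comm _ _ _).1 hy)
    have := pow_le_pow_of_le_one hθ0.le hθ1.le (hm.trans (Nat.le_succ _))
    exact mul_le_mul (le_abs_self C) this (by positivity) (abs_nonneg C)

theorem continuous_of_cylinder_bound {θ A : ℝ} (hθ0 : 0 < θ) (hθ1 : θ < 1) {f : Space d → ℝ}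
    (hf : ∀ (m : ℕ) (x y : Space d), y ∈ PiNat.cylinder x m → f y - f x ≤ A * θ ^ m) :
    Continuous f := by
  rw [continuous_iff_continuousAt]
  intro x
  rw [ContinuousAt, Metric.tendsto_nhds]
  intro ε hε
  have ht : Tendsto (fun m : ℕ => A * θ ^ m) atTop (𝓝 0) := by
    simpa using (tendsto_pow_atTop_nhds_zero_of_lt_one hθ0.le hθ1).const_mul A
  obtain ⟨m, hm⟩ := (ht.eventually (gt_mem_nhds hε)).exists
  filter_upwards [(PiNat.isOpen_cylinder _ x m).mem_nhds (PiNat.self_mem_cylinder x m)] with y hy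
  rw [Real.dist_eq, abs_lt]
  have h1 := hf m x y hy
  have h2 := hf m y x ((PiNat.mem_cylinder_comm _ _ _).1 hy)
  constructor <;> linarith

theorem VariationBound.continuous {θ B : ℝ} (hθ0 : 0 < θ) (hθ1 : θ < 1) {f : Space d → ℝ}
    (hf : VariationBound θ B f) : Continuous f :=
  continuous_of_cylinder_bound hθ0 hθ1 hf

theorem exists_cylinder_sub_le {V : Space d → ℝ} (hV : Continuous V) {ε : ℝ} (hε : 0 < ε) :
    ∃ n : ℕ, ∀ x y, y ∈ PiNat.cylinder x n → V y - V x ≤ ε := by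
  let _ : MetricSpace (Space d) := PiNat.metricSpace
  have hu := CompactSpace.uniformContinuous_of_continuous hV
  rw [Metric.uniformContinuous_iff] at hu
  obtain ⟨δ, hδ, h⟩ := hu ε hε
  obtain ⟨n, hn⟩ := exists_pow_lt_of_lt_one hδ (by norm_num : (1 / 2 : ℝ) < 1)
  refine ⟨n, fun x y hy => ?_⟩
  have := h (PiNat.mem_cylinder_iff_dist_le.1 hy |>.trans_lt hn)
  rw [Real.dist_eq] at this
  exact (le_abs_self _).trans this.le

/-- Uniform continuity makes the oscillation negligible at a fine scale; coarsening up to the whole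
space adds a geometric series of sum at most `A`. Only continuity of `V` is needed. Serves both
sub-actions and logarithms of eigenfunctions. -/
theorem sub_le_of_cylinder_step {θ A : ℝ} {V : Space d → ℝ} (hθ0 : 0 < θ) (hA : 0 ≤ A)
    (hV : Continuous V)
    (hstep : ∀ (n : ℕ) (K : ℝ), (∀ x y, y ∈ PiNat.cylinder x (n + 1) → V y - V x ≤ K) →
      ∀ x y, y ∈ PiNat.cylinder x n → V y - V x ≤ K + A * (1 - θ) * θ ^ n) (x y : Space d) :
    V y - V x ≤ A := by
  have key : ∀ (n : ℕ) (K : ℝ), (∀ x y, y ∈ PiNat.cylinder x n → V y - V x ≤ K) →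
      ∀ x y, V y - V x ≤ K + A * (1 - θ ^ n) := by
    intro n
    induction n with
    | zero => intro K h x y; simpa using h x y (by simp)
    | succ n ih =>
      intro K h x y
      have := ih _ (hstep n K h) x y
      rw [pow_succ]
      linarith
  refine le_of_forall_pos_le_add fun ε hε => ?_
  obtain ⟨n, hn⟩ := exists_cylinder_sub_le hV hε
  have h1 := key n ε hn x y
  have h2 : 0 ≤ A * θ ^ n := by positivity
  linarith

theorem VariationBound.birkhoffSum_sub_le {θ B : ℝ}
    {f : Space d → ℝ} (hf : VariationBound θ B f) (n : ℕ) (x y : Space d)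
    (hy : y ∈ PiNat.cylinder x n) :
    birkhoffSum shift f n y - birkhoffSum shift f n x ≤ B * (1 - θ ^ n) := by
  induction n generalizing x y with
  | zero => simp
  | succ n ih =>
    rw [birkhoffSum_succ', birkhoffSum_succ']
    have h1 := ih _ _ (shift_mem_cylinder hy)
    have h2 := hf n x y (PiNat.cylinder_anti x n.le_succ hy)
    rw [pow_succ]
    linarith

theorem VariationBound.birkhoffSum_sub_le' {θ B : ℝ} (hθ0 : 0 < θ) (hB : 0 ≤ B)
    {f : Space d → ℝ} (hf : VariationBound θ B f) {n : ℕ} {x y : Space d}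
    (hy : y ∈ PiNat.cylinder x n) :
    birkhoffSum shift f n y - birkhoffSum shift f n x ≤ B := by
  have h1 := hf.birkhoffSum_sub_le n x y hy
  have h2 : 0 ≤ B * θ ^ n := by positivity
  linarith

/-! ### Invariant probabilities and periodic orbits -/

theorem integrable_of_continuous {f : Space d → ℝ} (hf : Continuous f) (ν : Measure (Space d))
    [IsFiniteMeasure ν] : Integrable f ν :=
  hf.integrable_of_hasCompactSupport (HasCompactSupport.of_compactSpace f)

theorem IsInvariantProb.integral_shift {ν : Measure (Space d)} (hν : IsInvariantProb ν)
    {f : Space d → ℝ} (hf : Continuous f) : ∫ x, f (shift x) ∂ν = ∫ x, f x ∂ν := by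
  conv_rhs => rw [← hν.2.map_eq]
  rw [integral_map hν.2.measurable.aemeasurable hf.aestronglyMeasurable]

theorem integral_le_maxValue {f : Space d → ℝ} (hf : Continuous f) {ν : Measure (Space d)}
    (hν : IsInvariantProb ν) : ∫ x, f x ∂ν ≤ maxValue f := by
  refine le_csSup ?_ ⟨ν, hν, rfl⟩
  obtain ⟨M, hM⟩ := (isCompact_range hf).bddAbove
  refine ⟨M, ?_⟩
  rintro _ ⟨ν', hν', rfl⟩
  have := hν'.1
  calc ∫ x, f x ∂ν' ≤ ∫ _, M ∂ν' :=
        integral_mono (integrable_of_continuous hf ν') (integrable_const M)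
          fun x => hM ⟨x, rfl⟩
    _ = M := by simp

theorem IsInvariantProb.integral_birkhoffSum {ν : Measure (Space d)} (hν : IsInvariantProb ν)
    {f : Space d → ℝ} (hf : Continuous f) (n : ℕ) :
    ∫ x, birkhoffSum shift f n x ∂ν = n * ∫ x, f x ∂ν := by
  have := hν.1
  have hc : ∀ n, Continuous fun x : Space d => f (shift^[n] x) :=
    fun n => hf.comp (continuous_shift.iterate n)
  have h1 : ∀ n, ∫ x, f (shift^[n] x) ∂ν = ∫ x, f x ∂ν := by
    intro n
    induction n with
    | zero => rfl
    | succ n ih =>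
      simp_rw [Function.iterate_succ_apply]
      rw [hν.integral_shift (hc n), ih]
  simp_rw [birkhoffSum]
  rw [integral_finsetSum _ fun i _ => integrable_of_continuous (hc i) ν]
  simp [h1]

/-- The equidistributed measure on the orbit of a periodic point. -/
theorem exists_isInvariantProb_of_periodic {n : ℕ} (hn : n ≠ 0) {p : Space d}
    (hp : shift^[n] p = p) :
    ∃ ν : Measure (Space d), IsInvariantProb ν ∧
      ∀ f : Space d → ℝ, ∫ x, f x ∂ν = birkhoffSum shift f n p / n := by
  have hn0 : (n : ℝ≥0∞) ≠ 0 := by exact_mod_cast hn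
  refine ⟨(n : ℝ≥0∞)⁻¹ • ∑ i ∈ Finset.range n, Measure.dirac (shift^[i] p), ⟨⟨?_⟩, ?_⟩, ?_⟩
  · simp [ENNReal.inv_mul_cancel hn0]
  · refine ⟨continuous_shift.measurable, ?_⟩
    rw [Measure.map_smul, ← Measure.mapₗ_apply_of_measurable continuous_shift.measurable, map_sum]
    congr 1
    -- Both expansions split the same sum of `n + 1` Dirac masses; as `shift^[n] p = p`, the removed
    -- end terms agree and cancel.
    have h1 := Finset.sum_range_succ' (fun i => Measure.dirac (shift^[i] p)) n
    have h2 := Finset.sum_range_succ (fun i => Measure.dirac (shift^[i] p)) n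
    have h3 : ∑ i ∈ Finset.range n, Measure.dirac (shift^[i + 1] p)
        = ∑ i ∈ Finset.range n, Measure.dirac (shift^[i] p) := by
      ext s hs
      have h4 := congrArg (fun ν : Measure (Space d) => ν s) (h1.symm.trans h2)
      simp only [hp, Measure.add_apply, Function.iterate_zero, id] at h4
      exact (ENNReal.add_left_inj (measure_ne_top _ _)).1 h4
    rw [← h3]
    refine Finset.sum_congr rfl fun i _ => ?_
    rw [Measure.mapₗ_apply_of_measurable continuous_shift.measurable,
      Measure.map_dirac' continuous_shift.measurable, Function.iterate_succ_apply']
  · intro f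
    rw [integral_smul_measure, integral_finsetSum_measure fun i _ => integrable_dirac (by simp)]
    simp [birkhoffSum, div_eq_inv_mul]

theorem birkhoffSum_le_of_periodic {f : Space d → ℝ} (hf : Continuous f) {n : ℕ} {p : Space d}
    (hp : shift^[n] p = p) : birkhoffSum shift f n p ≤ n * maxValue f := by
  rcases eq_or_ne n 0 with rfl | hn
  · simp
  · obtain ⟨ν, hν, h⟩ := exists_isInvariantProb_of_periodic hn hp
    have := integral_le_maxValue hf hν
    rw [h, div_le_iff₀ (by positivity)] at this
    linarith

theorem exists_periodic_mem_cylinder (z : Space d) (n : ℕ) :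
    ∃ p : Space d, shift^[n] p = p ∧ z ∈ PiNat.cylinder p n := by
  refine ⟨fun i => z (i % n), ?_, fun i hi => ?_⟩
  · funext i
    rw [iterate_shift_apply, Nat.add_mod_right]
  · exact congrArg z (Nat.mod_eq_of_lt hi).symm

/-- Closing up the first `n` symbols of `z` gives a periodic point, whose sum is at most `n β(f)`;
the replacement costs at most `B`. -/
theorem VariationBound.birkhoffSum_le {θ B : ℝ} (hθ0 : 0 < θ) (hθ1 : θ < 1) (hB : 0 ≤ B)
    {f : Space d → ℝ} (hf : VariationBound θ B f) (n : ℕ) (z : Space d) :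
    birkhoffSum shift f n z ≤ n * maxValue f + B := by
  obtain ⟨p, hp, hz⟩ := exists_periodic_mem_cylinder z n
  have h1 := birkhoffSum_le_of_periodic (hf.continuous hθ0 hθ1) hp
  have h2 := hf.birkhoffSum_sub_le' hθ0 hB hz
  linarith

/-! ### Max-plus iterates and existence of calibrated sub-actions -/

/-- The iterates of the zero function under the operator
`u ↦ max {u(x) + f(x) - β : σ(x) = ·}`. -/
noncomputable def maxIterate [NeZero d] (f : Space d → ℝ) (β : ℝ) : ℕ → Space d → ℝ
  | 0, _ => 0
  | n + 1, y => Finset.univ.sup' Finset.univ_nonempty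
      fun a : Fin d => maxIterate f β n (cons a y) + f (cons a y) - β

section maxIterate

variable [NeZero d] {f : Space d → ℝ} {β : ℝ}

theorem le_maxIterate_succ (n : ℕ) (a : Fin d) (y : Space d) :
    maxIterate f β n (cons a y) + f (cons a y) - β ≤ maxIterate f β (n + 1) y :=
  Finset.le_sup' (fun a : Fin d => maxIterate f β n (cons a y) + f (cons a y) - β)
    (Finset.mem_univ a)

theorem exists_maxIterate_succ_eq (n : ℕ) (y : Space d) :
    ∃ a : Fin d,
      maxIterate f β (n + 1) y = maxIterate f β n (cons a y) + f (cons a y) - β := by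
  obtain ⟨a, -, h⟩ := Finset.exists_mem_eq_sup' (Finset.univ_nonempty (α := Fin d))
    fun a : Fin d => maxIterate f β n (cons a y) + f (cons a y) - β
  exact ⟨a, h⟩

theorem exists_maxIterate_eq_birkhoffSum (n : ℕ) (y : Space d) :
    ∃ z, shift^[n] z = y ∧ maxIterate f β n y = birkhoffSum shift f n z - n * β := by
  induction n generalizing y with
  | zero => exact ⟨y, rfl, by simp [maxIterate]⟩
  | succ n ih =>
    obtain ⟨a, ha⟩ := exists_maxIterate_succ_eq (f := f) (β := β) n y
    obtain ⟨z, hz, h⟩ := ih (cons a y)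
    refine ⟨z, by rw [Function.iterate_succ_apply', hz, shift_cons], ?_⟩
    rw [ha, h, birkhoffSum_succ, hz]
    push_cast
    ring

theorem birkhoffSum_le_maxIterate (n : ℕ) (z : Space d) :
    birkhoffSum shift f n z - n * β ≤ maxIterate f β n (shift^[n] z) := by
  induction n with
  | zero => simp [maxIterate]
  | succ n ih =>
    have h := le_maxIterate_succ (f := f) (β := β) n (shift^[n] z 0) (shift (shift^[n] z))
    rw [cons_shift, ← Function.iterate_succ_apply' shift n z] at h
    rw [birkhoffSum_succ]
    push_cast
    linarith

theorem VariationBound.maxIterate_sub_le {θ B : ℝ} (hθ0 : 0 < θ) (hB : 0 ≤ B)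
    (hf : VariationBound θ B f) (n m : ℕ) (x y : Space d) (hy : y ∈ PiNat.cylinder x m) :
    maxIterate f β n y - maxIterate f β n x ≤ B * θ ^ m := by
  induction n generalizing m x y with
  | zero => simp only [maxIterate, sub_self]; positivity
  | succ n ih =>
    obtain ⟨a, ha⟩ := exists_maxIterate_succ_eq (f := f) (β := β) n y
    have h1 := le_maxIterate_succ (f := f) (β := β) n a x
    have hc := cons_mem_cylinder hy a
    have h2 := ih _ _ _ hc
    have h3 := hf m _ _ (PiNat.cylinder_anti _ m.le_succ hc)
    rw [pow_succ] at h2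
    linarith

theorem VariationBound.abs_maxIterate_le {θ B : ℝ} (hθ0 : 0 < θ) (hθ1 : θ < 1) (hB : 0 ≤ B)
    (hf : VariationBound θ B f) {ν : Measure (Space d)} (hν : IsMaximizing f ν) (n : ℕ)
    (y : Space d) : |maxIterate f (maxValue f) n y| ≤ B := by
  rw [abs_le]
  constructor
  · have := hν.1.1
    have hc := hf.continuous hθ0 hθ1
    -- Some point has Birkhoff sum at least its mean `n β(f)`; the oscillation bound carries this
    -- from `shift^[n] z` to `y`.
    obtain ⟨z, hz⟩ := exists_integral_le (μ := ν) (f := birkhoffSum shift f n)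
      (integrable_of_continuous (continuous_finsetSum _ fun i _ =>
        hc.comp (continuous_shift.iterate i)) ν)
    rw [hν.1.integral_birkhoffSum hc, hν.2] at hz
    have h1 := birkhoffSum_le_maxIterate (f := f) (β := maxValue f) n z
    have h2 := hf.maxIterate_sub_le (β := maxValue f) hθ0 hB n 0 y (shift^[n] z) (by simp)
    rw [pow_zero] at h2
    linarith
  · obtain ⟨z, -, h⟩ := exists_maxIterate_eq_birkhoffSum (f := f) (β := maxValue f) n y
    have := hf.birkhoffSum_le hθ0 hθ1 hB n z
    linarith

end maxIterate

theorem VariationBound.exists_isCalibratedSubaction [NeZero d] {θ B : ℝ} (hθ0 : 0 < θ)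
    (hθ1 : θ < 1) (hB : 0 ≤ B) {f : Space d → ℝ} (hf : VariationBound θ B f)
    {ν : Measure (Space d)} (hν : IsMaximizing f ν) : ∃ V, IsCalibratedSubaction f V := by
  set β := maxValue f with hβ
  set U := maxIterate f β with hU
  have habs : ∀ n y, -B ≤ U n y ∧ U n y ≤ B :=
    fun n y => abs_le.1 (hf.abs_maxIterate_le hθ0 hθ1 hB hν n y)
  have hbd : ∀ y, IsBoundedUnder (· ≤ ·) atTop fun n => U n y :=
    fun y => isBoundedUnder_of ⟨B, fun n => (habs n y).2⟩
  have hcobd : ∀ y, IsCoboundedUnder (· ≤ ·) atTop fun n => U n y :=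
    fun y => (isBoundedUnder_of ⟨-B, fun n => (habs n y).1⟩ :
      IsBoundedUnder (· ≥ ·) atTop fun n => U n y).isCoboundedUnder_le
  let V : Space d → ℝ := fun y => limsup (fun n => U n y) atTop
  have hlt : ∀ {y r}, V y < r → ∀ᶠ n in atTop, U n y < r :=
    fun {y r} h => eventually_lt_of_limsup_lt h (hbd y)
  have hle : ∀ {y r}, (∀ᶠ n in atTop, U n y ≤ r) → V y ≤ r :=
    fun {y r} h => limsup_le_of_le (hcobd y) h
  have hge : ∀ a y, V (cons a y) + f (cons a y) - β ≤ V y := by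
    intro a y
    refine le_of_forall_gt_imp_ge_of_dense fun r hr => ?_
    have h1 := (tendsto_add_atTop_nat 1).eventually (hlt hr)
    have h2 : V (cons a y) ≤ r - f (cons a y) + β := hle <| h1.mono fun n hn => by
      have := le_maxIterate_succ (f := f) (β := β) n a y
      linarith
    linarith
  refine ⟨V, continuous_of_cylinder_bound hθ0 hθ1 (A := B) fun m x y hy => ?_, fun y => ⟨?_, ?_⟩⟩
  · have : V y ≤ V x + B * θ ^ m := by
      refine le_of_forall_pos_le_add fun ε hε => ?_
      refine hle ((hlt (lt_add_of_pos_right (V x) hε)).mono fun n hn => ?_)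
      have := hf.maxIterate_sub_le (β := β) hθ0 hB n m x y hy
      linarith
    linarith
  · by_contra hne
    have h : ∀ a, V (cons a y) + f (cons a y) - β < V y := fun a =>
      lt_of_le_of_ne (hge a y) fun h => hne ⟨cons a y, rfl, h.symm⟩
    obtain ⟨a₀, h₀⟩ := Finite.exists_max fun a : Fin d => V (cons a y) + f (cons a y) - β
    obtain ⟨r, hr1, hr2⟩ := exists_between (h a₀)
    refine absurd hr2 (not_lt.2 ?_)
    have h1 : ∀ᶠ n in atTop, ∀ a : Fin d, U n (cons a y) < r - f (cons a y) + β :=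
      eventually_all.2 fun a => hlt (by linarith [h₀ a])
    obtain ⟨N, hN⟩ := eventually_atTop.1 h1
    refine hle (eventually_atTop.2 ⟨N + 1, fun n hn => ?_⟩)
    obtain ⟨n, rfl⟩ : ∃ k, n = k + 1 := ⟨n - 1, by omega⟩
    obtain ⟨a, ha⟩ := exists_maxIterate_succ_eq (f := f) (β := β) n y
    have := hN n (by omega) a
    rw [hU, ha]
    linarith
  · rintro _ ⟨x, rfl, rfl⟩
    have := hge (x 0) (shift x)
    rwa [cons_shift] at this

/-! ### Bounds for calibrated sub-actions and `I_BLT` -/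

theorem IsCalibratedSubaction.le {f V : Space d → ℝ} (hV : IsCalibratedSubaction f V)
    (x : Space d) : 0 ≤ V (shift x) - V x - f x + maxValue f := by
  have := (hV.2 (shift x)).2 ⟨x, rfl, rfl⟩
  linarith

theorem IsCalibratedSubaction.sub_le {θ B : ℝ} (hθ0 : 0 < θ) (hB : 0 ≤ B)
    {f V : Space d → ℝ} (hf : VariationBound θ B f) (hV : IsCalibratedSubaction f V)
    (x y : Space d) : V y - V x ≤ B := by
  refine sub_le_of_cylinder_step hθ0 hB hV.1 (fun n K hK x y hy => ?_) x y
  -- Prepending to `x` the first symbol of an optimal preimage of `y` gives a competitor for `V x`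
  -- that agrees with `u` on one more symbol.
  obtain ⟨u, hu, h⟩ := (hV.2 y).1
  have hc := cons_mem_cylinder hy (u 0)
  have hcu : cons (u 0) y = u := by rw [← hu, cons_shift]
  have h1 := (hV.2 x).2 ⟨cons (u 0) x, rfl, rfl⟩
  have h2 := hK _ _ hc
  have h3 := hf n _ _ (PiNat.cylinder_anti _ n.le_succ hc)
  rw [hcu] at h2 h3
  linarith

/-- The terms are non-negative, so each partial sum is a lower bound, and the `V` part telescopes.
-/
theorem IsCalibratedSubaction.le_bltRate {f V : Space d → ℝ} (hV : IsCalibratedSubaction f V)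
    (n : ℕ) (z : Space d) :
    ((V (shift^[n] z) - V z + n * maxValue f - birkhoffSum shift f n z : ℝ) : EReal) ≤
      bltRate f V z := by
  let R : ℕ → ℝ := fun i =>
    V (shift^[i + 1] z) - V (shift^[i] z) - f (shift^[i] z) + maxValue f
  have hR : ∀ i, 0 ≤ R i := fun i => by
    simp only [R, Function.iterate_succ_apply']
    exact hV.le _
  have hsum : ∀ n : ℕ, ∑ i ∈ Finset.range n, R i =
      V (shift^[n] z) - V z + n * maxValue f - birkhoffSum shift f n z := by
    intro n
    induction n with
    | zero => simp
    | succ n ih =>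
      rw [Finset.sum_range_succ, ih, birkhoffSum_succ]
      simp only [R]
      push_cast
      ring
  rw [← hsum]
  have h1 := ENNReal.sum_le_tsum (f := fun i => ENNReal.ofReal (R i)) (Finset.range n)
  rw [← ENNReal.ofReal_sum_of_nonneg fun i _ => hR i] at h1
  have h2 := EReal.coe_ennreal_le_coe_ennreal_iff.2 h1
  rwa [EReal.coe_ennreal_ofReal, max_eq_left (Finset.sum_nonneg fun i _ => hR i)] at h2

/-! ### Fixed points and the two rates -/

/-- The fixed point `a a a …` of the shift. -/
def constPoint (a : Fin d) : Space d := fun _ => a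

@[simp] theorem shift_constPoint (a : Fin d) : shift (constPoint a) = constPoint a := rfl

@[simp] theorem cons_constPoint (a : Fin d) : cons a (constPoint a) = constPoint a :=
  cons_shift (constPoint a)

theorem birkhoffSum_constPoint (f : Space d → ℝ) (a : Fin d) (n : ℕ) :
    birkhoffSum shift f n (constPoint a) = n * f (constPoint a) := by
  have : ∀ i, shift^[i] (constPoint a) = constPoint a :=
    fun i => Function.iterate_fixed (shift_constPoint a) i
  simp [birkhoffSum, this]

theorem isInvariantProb_dirac (a : Fin d) : IsInvariantProb (Measure.dirac (constPoint a)) :=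
  ⟨inferInstance, continuous_shift.measurable, by
    rw [Measure.map_dirac' continuous_shift.measurable, shift_constPoint]⟩

theorem exists_constPoint_lt_maxValue (hd : 2 ≤ d) {f : Space d → ℝ} (hf : Continuous f)
    (huniq : ∃! μ : Measure (Space d), IsMaximizing f μ) :
    ∃ a : Fin d, f (constPoint a) < maxValue f := by
  by_contra! h
  have hmax : ∀ a : Fin d, IsMaximizing f (Measure.dirac (constPoint a)) := fun a =>
    ⟨isInvariantProb_dirac a, le_antisymm (integral_le_maxValue hf (isInvariantProb_dirac a))
      (by rw [integral_dirac]; exact h a)⟩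
  let a : Fin d := ⟨0, by omega⟩
  let b : Fin d := ⟨1, by omega⟩
  have hab := huniq.unique (hmax a) (hmax b)
  have hne : constPoint b ≠ constPoint a := fun h => by simpa [constPoint, a, b] using congrFun h 0
  have h1 := congrArg (fun ν : Measure (Space d) => ν {constPoint a}) hab
  simp [hne] at h1

theorem zetaRate_le_perRate (θ : ℝ) (f : Space d → ℝ) {x : Space d}
    (hx : x ∈ Function.periodicPts shift) : zetaRate θ f x ≤ perRate f x :=
  iSup₂_le fun ε hε => iInf₂_le x ⟨hx, by
    rw [thetaDist, if_pos rfl]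
    exact (Set.mem_Ioi.1 hε).le⟩

theorem zetaRate_constPoint_le (θ : ℝ) (f : Space d → ℝ) (a : Fin d) :
    zetaRate θ f (constPoint a) ≤ ((maxValue f - f (constPoint a) : ℝ) : EReal) := by
  have hfix : Function.IsFixedPt shift (constPoint a) := shift_constPoint a
  have h1 : Function.minimalPeriod shift (constPoint a) = 1 :=
    Function.minimalPeriod_eq_one_iff_isFixedPt.2 hfix
  have h := zetaRate_le_perRate θ f
    (Function.mk_mem_periodicPts one_pos (hfix.isPeriodicPt 1))
  simpa [perRate, h1, birkhoffSum_one] using h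

theorem IsCalibratedSubaction.le_bltRate_of_mem_cylinder {θ B : ℝ} (hθ0 : 0 < θ)
    (hB : 0 ≤ B) {f V : Space d → ℝ} (hf : VariationBound θ B f)
    (hV : IsCalibratedSubaction f V) (a : Fin d) (n : ℕ) {z : Space d}
    (hz : z ∈ PiNat.cylinder (constPoint a) n) :
    ((n * (maxValue f - f (constPoint a)) - 2 * B : ℝ) : EReal) ≤ bltRate f V z := by
  refine le_trans (EReal.coe_le_coe_iff.2 ?_) (hV.le_bltRate n z)
  have h1 := hV.sub_le hθ0 hB hf (shift^[n] z) z
  have h2 := hf.birkhoffSum_sub_le' hθ0 hB hz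
  rw [birkhoffSum_constPoint] at h2
  linarith

/-! ### Gibbs states on cylinders around a fixed point -/

section Gibbs

variable {f h : Space d → ℝ} {c lam : ℝ}

/-- Keeping one branch of the eigenvalue equation bounds `c f` by `log lam` plus a coboundary, which
integrates to zero against a maximizing measure. -/
theorem mul_maxValue_le_log_eigenvalue (hf : Continuous f) (hh : Continuous h)
    (hh0 : ∀ x, 0 < h x) (hlam : 0 < lam)
    (heig : ∀ y, ruelle (fun x => c * f x) h y = lam * h y)
    {ν : Measure (Space d)} (hν : IsMaximizing f ν) : c * maxValue f ≤ Real.log lam := by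
  have := hν.1.1
  have hlog : Continuous fun x => Real.log (h x) := hh.log fun x => (hh0 x).ne'
  have hpt : ∀ x, c * f x ≤ Real.log lam + Real.log (h (shift x)) - Real.log (h x) := by
    intro x
    have h1 : Real.exp (c * f x) * h x ≤ lam * h (shift x) := by
      rw [← heig, ruelle]
      have := Finset.single_le_sum
        (f := fun a => Real.exp (c * f (cons a (shift x))) * h (cons a (shift x)))
        (fun a _ => mul_nonneg (Real.exp_pos _).le (hh0 _).le) (Finset.mem_univ (x 0))
      simpa only [cons_shift] using this
    have h2 := Real.log_le_log (mul_pos (Real.exp_pos _) (hh0 x)) h1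
    rw [Real.log_mul (Real.exp_pos _).ne' (hh0 x).ne', Real.log_exp,
      Real.log_mul hlam.ne' (hh0 _).ne'] at h2
    linarith
  have i1 : Integrable (fun x => Real.log (h (shift x))) ν :=
    integrable_of_continuous (hlog.comp continuous_shift) ν
  have i2 := integrable_of_continuous hlog ν
  have i3 : Integrable (fun x => Real.log lam + Real.log (h (shift x))) ν :=
    (integrable_const _).add i1
  have hint := integral_mono ((integrable_of_continuous hf ν).const_mul c) (i3.sub i2) hpt
  have hadd : ∫ x, (Real.log lam + Real.log (h (shift x))) ∂ν =
      Real.log lam + ∫ x, Real.log (h (shift x)) ∂ν := by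
    rw [integral_add (integrable_const _) i1]
    simp
  simp only [Pi.sub_apply] at hint
  rw [integral_const_mul, hν.2, integral_sub i3 i2, hadd, hν.1.integral_shift hlog] at hint
  linarith

theorem log_eigenfunction_sub_le {θ B : ℝ} (hθ0 : 0 < θ) (hB : 0 ≤ B) (hc : 0 ≤ c)
    (hf : VariationBound θ B f) (hh : Continuous h) (hh0 : ∀ x, 0 < h x) (hlam : 0 < lam)
    (heig : ∀ y, ruelle (fun x => c * f x) h y = lam * h y) (x y : Space d) :
    Real.log (h y) - Real.log (h x) ≤ c * B := by
  refine sub_le_of_cylinder_step (θ := θ) (V := fun x => Real.log (h x)) hθ0 (by positivity)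
    (hh.log fun x => (hh0 x).ne') (fun n K hK x y hy => ?_) x y
  set E := K + c * B * (1 - θ) * θ ^ n with hE
  suffices hs : lam * h y ≤ lam * (Real.exp E * h x) by
    have := Real.log_le_log (hh0 y) (le_of_mul_le_mul_left hs hlam)
    rw [Real.log_mul (Real.exp_pos _).ne' (hh0 x).ne', Real.log_exp] at this
    linarith
  rw [mul_left_comm, ← heig, ← heig, ruelle, ruelle, Finset.mul_sum]
  refine Finset.sum_le_sum fun a _ => ?_
  have hca := cons_mem_cylinder hy a
  have h1 := hK _ _ hca
  have h2 := mul_le_mul_of_nonneg_left (hf n _ _ (PiNat.cylinder_anti _ n.le_succ hca)) hc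
  rw [← Real.exp_log (hh0 (cons a y)), ← Real.exp_log (hh0 (cons a x)), ← Real.exp_add,
    ← Real.exp_add, ← Real.exp_add, Real.exp_le_exp]
  linarith

/-- Duality is tested on the indicator of the longer cylinder, continuous since cylinders are
clopen; only the branch `a` contributes. -/
theorem measureReal_cylinder_succ_le {θ B : ℝ} (hc : 0 ≤ c) (hf : VariationBound θ B f)
    {ν : Measure (Space d)} [IsProbabilityMeasure ν]
    (heig : ∀ u : Space d → ℝ, Continuous u →
      ∫ y, ruelle (fun x => c * f x) u y ∂ν = lam * ∫ x, u x ∂ν) (a : Fin d) (n : ℕ) :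
    lam * ν.real (PiNat.cylinder (constPoint a) (n + 1)) ≤
      Real.exp (c * (f (constPoint a) + B * (1 - θ) * θ ^ n)) *
        ν.real (PiNat.cylinder (constPoint a) n) := by
  have hcl : ∀ m, IsClopen (PiNat.cylinder (constPoint a) m) := isClopen_cylinder _
  have hcont : ∀ m, Continuous ((PiNat.cylinder (constPoint a) m).indicator (1 : Space d → ℝ)) :=
    fun m => (hcl m).continuous_indicator continuous_one
  have hint : ∀ m, ∫ x, (PiNat.cylinder (constPoint a) m).indicator (1 : Space d → ℝ) x ∂ν =
      ν.real (PiNat.cylinder (constPoint a) m) :=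
    fun m => integral_indicator_one (hcl m).isOpen.measurableSet
  rw [← hint, ← hint, ← heig _ (hcont _), ← integral_const_mul]
  refine integral_mono_of_nonneg (ae_of_all _ fun y => ?_)
    ((integrable_of_continuous (hcont n) ν).const_mul _) (ae_of_all _ fun y => ?_)
  · exact Finset.sum_nonneg fun b _ => mul_nonneg (Real.exp_pos _).le
      (Set.indicator_nonneg (fun _ _ => zero_le_one) _)
  · simp only [ruelle]
    rw [Finset.sum_eq_single a]
    · by_cases hy : y ∈ PiNat.cylinder (constPoint a) n
      · have hca := cons_mem_cylinder hy a
        rw [cons_constPoint] at hca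
        have h1 := hf n _ _ (PiNat.cylinder_anti _ n.le_succ hca)
        rw [Set.indicator_of_mem hca, Set.indicator_of_mem hy]
        simp only [Pi.one_apply, mul_one, Real.exp_le_exp]
        exact mul_le_mul_of_nonneg_left (by linarith) hc
      · have hca : cons a y ∉ PiNat.cylinder (constPoint a) (n + 1) :=
          fun h => hy (shift_mem_cylinder h)
        rw [Set.indicator_of_notMem hca, Set.indicator_of_notMem hy, mul_zero, mul_zero]
    · intro b _ hb
      have hcb : cons b y ∉ PiNat.cylinder (constPoint a) (n + 1) :=
        fun hmem => hb (hmem 0 n.succ_pos)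
      rw [Set.indicator_of_notMem hcb, mul_zero]
    · simp

theorem measureReal_cylinder_le {θ B β : ℝ} (hc : 0 ≤ c) (hf : VariationBound θ B f)
    {ν : Measure (Space d)} [IsProbabilityMeasure ν] (hlam : 0 < lam)
    (hβ : c * β ≤ Real.log lam)
    (heig : ∀ u : Space d → ℝ, Continuous u →
      ∫ y, ruelle (fun x => c * f x) u y ∂ν = lam * ∫ x, u x ∂ν) (a : Fin d) (n : ℕ) :
    ν.real (PiNat.cylinder (constPoint a) n) ≤
      Real.exp (-(c * (n * (β - f (constPoint a)) - B * (1 - θ ^ n)))) := by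
  induction n with
  | zero => simp
  | succ n ih =>
    have h1 := measureReal_cylinder_succ_le hc hf heig a n
    have h2 : Real.exp (c * β) ≤ lam := (Real.le_log_iff_exp_le hlam).1 hβ
    have h3 := (mul_le_mul_of_nonneg_right h2 measureReal_nonneg).trans
      (h1.trans (mul_le_mul_of_nonneg_left ih (Real.exp_pos _).le))
    rw [← Real.exp_add] at h3
    rw [← mul_le_mul_iff_right₀ (Real.exp_pos (c * β)), ← Real.exp_add]
    refine h3.trans_eq (congrArg Real.exp ?_)
    push_cast
    ring

end Gibbs

theorem IsGibbsState.log_cylinder_div_le {θ B c : ℝ} (hθ0 : 0 < θ) (hθ1 : θ < 1) (hB : 0 ≤ B)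
    (hc : 0 < c) {f : Space d → ℝ} (hf : VariationBound θ B f) {ν₀ μ : Measure (Space d)}
    (hν₀ : IsMaximizing f ν₀) (hμ : IsGibbsState (fun x => c * f x) μ) (a : Fin d) (n : ℕ) :
    ENNReal.log (μ (PiNat.cylinder (constPoint a) n)) / (c : EReal) ≤
      ((-(n * (maxValue f - f (constPoint a)) - 2 * B) : ℝ) : EReal) := by
  obtain ⟨lam, h, ν, hlam, hh, hh0, hν, heig, hdual, hint, rfl⟩ := hμ
  have hmeas := (isClopen_cylinder (constPoint a) n).isOpen.measurableSet
  have hlog := mul_maxValue_le_log_eigenvalue (hf.continuous hθ0 hθ1) hh hh0 hlam heig hν₀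
  have hosc := log_eigenfunction_sub_le hθ0 hB hc.le hf hh hh0 hlam heig
  have hsup : ∀ y, h y ≤ Real.exp (c * B) := by
    intro y
    -- Integrating in `x` turns the oscillation bound into a sup bound, because `∫ h dν = 1`.
    have h1 : ∀ x, h y ≤ Real.exp (c * B) * h x := fun x => by
      rw [← Real.exp_log (hh0 x), ← Real.exp_add, ← Real.log_le_iff_le_exp (hh0 y)]
      linarith [hosc x y]
    have h2 := integral_mono (μ := ν) (integrable_const (h y))
      ((integrable_of_continuous hh ν).const_mul _) h1
    rw [integral_const_mul, hint] at h2
    simpa using h2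
  set k := PiNat.cylinder (constPoint a) n
  set L := n * (maxValue f - f (constPoint a)) - 2 * B with hL
  have hk : (ν.withDensity fun x => ENNReal.ofReal (h x)) k ≤
      ENNReal.ofReal (Real.exp (-(c * L))) := by
    rw [withDensity_apply _ hmeas]
    calc ∫⁻ x in k, ENNReal.ofReal (h x) ∂ν
        ≤ ∫⁻ _ in k, ENNReal.ofReal (Real.exp (c * B)) ∂ν :=
          lintegral_mono fun x => ENNReal.ofReal_le_ofReal (hsup x)
      _ = ENNReal.ofReal (Real.exp (c * B) * ν.real k) := by
          rw [setLIntegral_const, ENNReal.ofReal_mul (Real.exp_pos _).le, ofReal_measureReal]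
      _ ≤ ENNReal.ofReal (Real.exp (-(c * L))) := by
          refine ENNReal.ofReal_le_ofReal ?_
          refine (mul_le_mul_of_nonneg_left
            (measureReal_cylinder_le hc.le hf hlam hlog hdual a n) (Real.exp_pos _).le).trans ?_
          rw [← Real.exp_add, Real.exp_le_exp, hL]
          have : 0 ≤ c * (B * θ ^ n) := by positivity
          linarith
  rw [EReal.div_le_iff_le_mul (by exact_mod_cast hc) (EReal.coe_ne_top c), ← EReal.coe_mul]
  refine (ENNReal.log_le_log hk).trans_eq ?_
  rw [ENNReal.log_ofReal_of_pos (Real.exp_pos _), Real.log_exp, mul_neg]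

end Bernoulli

/-! ### Choice of the cylinder and conclusion -/

theorem proposition15 (d : ℕ) (hd : 2 ≤ d) (θ : ℝ) (hθ0 : 0 < θ) (hθ1 : θ < 1)
    (f : Bernoulli.Space d → ℝ) (hpos : ∀ x, 0 < f x) (hf : Bernoulli.IsLipschitz θ f)
    (huniq : ∃! μ : Measure (Bernoulli.Space d), Bernoulli.IsMaximizing f μ) :
    (∃ V : Bernoulli.Space d → ℝ, Bernoulli.IsCalibratedSubaction f V) ∧
    ∃ k : Set (Bernoulli.Space d), Bernoulli.IsCylinder k ∧
      (∀ V : Bernoulli.Space d → ℝ, Bernoulli.IsCalibratedSubaction f V →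
        (⨅ x ∈ k, Bernoulli.zetaRate θ f x) ≠ (⨅ x ∈ k, Bernoulli.bltRate f V x)) ∧
      (∀ μ : ℝ → Measure (Bernoulli.Space d),
        (∀ c : ℝ, 0 < c → Bernoulli.IsGibbsState (fun x => c * f x) (μ c)) →
        ¬ Tendsto (fun c : ℝ => ENNReal.log (μ c k) / (c : EReal)) atTop
          (𝓝 (-(⨅ x ∈ k, Bernoulli.zetaRate θ f x)))) := by
  obtain ⟨B, hB, hvar⟩ := hf.exists_variationBound hθ0 hθ1
  obtain ⟨ν₀, hν₀, -⟩ := id huniq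
  have : NeZero d := ⟨by omega⟩
  refine ⟨hvar.exists_isCalibratedSubaction hθ0 hθ1 hB hν₀, ?_⟩
  obtain ⟨a, ha⟩ := Bernoulli.exists_constPoint_lt_maxValue hd (hvar.continuous hθ0 hθ1) huniq
  set I := Bernoulli.maxValue f - f (Bernoulli.constPoint a) with hI
  have hI0 : 0 < I := sub_pos.2 ha
  -- This is exactly `N I - 2B > I`, which separates the two infima.
  obtain ⟨N, hN⟩ := exists_nat_gt ((I + 2 * B) / I)
  rw [div_lt_iff₀ hI0] at hN
  have hL : (I : EReal) < ((N * I - 2 * B : ℝ) : EReal) :=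
    EReal.coe_lt_coe_iff.2 (by linarith)
  have hzeta : (⨅ x ∈ PiNat.cylinder (Bernoulli.constPoint a) N, Bernoulli.zetaRate θ f x) ≤ I :=
    (iInf₂_le _ (PiNat.self_mem_cylinder _ N)).trans (Bernoulli.zetaRate_constPoint_le θ f a)
  refine ⟨_, ⟨Bernoulli.constPoint a, N, rfl⟩, fun V hV => ?_, fun μ hμ hlim => ?_⟩
  · refine ((hzeta.trans_lt hL).trans_le ?_).ne
    exact le_iInf₂ fun z hz => hV.le_bltRate_of_mem_cylinder hθ0 hB hvar a N hz
  · have h1 := le_of_tendsto hlim <| (eventually_gt_atTop 0).mono fun c hc =>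
      (hμ c hc).log_cylinder_div_le hθ0 hθ1 hB hc hvar hν₀ a N
    rw [EReal.coe_neg, EReal.neg_le_neg_iff] at h1
    exact absurd (hL.trans_le (h1.trans hzeta)) (lt_irrefl _)
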